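/- Let $p\ge 3$ be an integer, let $\omega_p=\exp(2\pi i/p)$, and let $f:\mathbb{C}\to\mathbb{C}$ be the entire function $$f(z)=\sum_{k=0}^{p-1}\exp(\omega_p^k z).$$ Let $V_0=\{x+iy\in\mathbb{C} : x,y\in\mathbb{R},\ y=\tan(\pi/p)\,x,\ x>0\}$ and, for $k=1,\dots,p-1$, let $V_k$ be the rotation of $V_0$ around the origin through the angle $2k\pi/p$. Then all the zeros of $f$ lie on the rays $V_0,\dots,V_{p-1}$; that is, if $z\in\mathbb{C}$ and $f(z)=0$, then $z\in V_0\cup\dots\cup V_{p-1}$. -/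

import Mathlib

namespace ExpSums

/-- The root of unity `ω_p = exp (2 π i / p)`. -/
noncomputable def omega (p : ℕ) : ℂ :=
  Complex.exp (2 * (Real.pi : ℂ) * Complex.I / (p : ℂ))

/-- The entire function `z ↦ ∑_{k=0}^{p-1} exp (ω_p ^ k * z)`. -/
noncomputable def expSum (p : ℕ) (z : ℂ) : ℂ :=
  ∑ k ∈ Finset.range p, Complex.exp (omega p ^ k * z)

/-- The open ray `V_0 = {x + i y : y = tan (π / p) * x, x > 0}`. -/
def baseRay (p : ℕ) : Set ℂ :=
  {z | z.im = Real.tan (Real.pi / (p : ℝ)) * z.re ∧ 0 < z.re}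

/-- The ray `V_k`: the rotation of `V_0` around the origin by the angle `2 k π / p`. -/
noncomputable def ray (p k : ℕ) : Set ℂ :=
  (fun z : ℂ => Complex.exp (((2 * (k : ℝ) * Real.pi / (p : ℝ) : ℝ) : ℂ) * Complex.I) * z) ''
    baseRay p

end ExpSums

namespace ExpSums

open Complex Filter Topology ComplexConjugate

/-! Write `f` for `expSum p`. On a circle `|z| = r`, the angular derivative of `|f|²` is `-2 Im
(conj f * z f')`. This is nonpositive when `Im (z ^ p) ≥ 0`, by a positivity property of Euler sums
that passes to the limit (`im_conj_eulerSum_mul_nonneg`). So `|f|` is antitone for arguments in `[0,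
π/p]`, and a zero before `π/p` would persist along an arc, forcing `f = 0` although `f 0 = p`.
Conjugation and rotation by `ω` carry this to all other sectors. -/

lemma isPrimitiveRoot_omega {p : ℕ} (hp : p ≠ 0) : IsPrimitiveRoot (omega p) p :=
  Complex.isPrimitiveRoot_exp p hp

lemma conj_omega (p : ℕ) : conj (omega p) = (omega p)⁻¹ := by
  rw [omega, ← exp_conj, ← Complex.exp_neg]
  simp [neg_div, Complex.conj_ofNat]

lemma expSum_zero (p : ℕ) : expSum p 0 = p := by simp [expSum]

lemma expSum_omega_mul {p : ℕ} (hp : p ≠ 0) (z : ℂ) : expSum p (omega p * z) = expSum p z := by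
  have h := (Finset.sum_range_succ' (fun k ↦ exp (omega p ^ k * z)) p).symm.trans
    (Finset.sum_range_succ (fun k ↦ exp (omega p ^ k * z)) p)
  rw [(isPrimitiveRoot_omega hp).pow_eq_one, pow_zero] at h
  simpa only [expSum, ← mul_assoc, ← pow_succ] using add_right_cancel h

lemma expSum_omega_pow_mul {p : ℕ} (hp : p ≠ 0) (k : ℕ) (z : ℂ) :
    expSum p (omega p ^ k * z) = expSum p z := by
  induction k with
  | zero => simp
  | succ k ih => rw [pow_succ', mul_assoc, expSum_omega_mul hp, ih]

lemma expSum_conj {p : ℕ} (hp : p ≠ 0) (z : ℂ) : expSum p (conj z) = conj (expSum p z) := by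
  have hω := isPrimitiveRoot_omega hp
  -- The extra factor `ω` turns the reflected exponent `p - 1 - k` into `p - k`, which is `-k`
  -- modulo `p`.
  rw [← expSum_omega_mul hp, expSum, expSum, map_sum, ← Finset.sum_range_reflect]
  refine Finset.sum_congr rfl fun k hk ↦ ?_
  rw [← exp_conj, map_mul, map_pow, conj_omega, ← mul_assoc, ← pow_succ, inv_pow]
  congr 2
  refine eq_inv_of_mul_eq_one_left ?_
  rw [← pow_add, ← hω.pow_eq_one]
  congr 1
  have := Finset.mem_range.1 hk
  omega

/-- The Euler approximations, with step `h`, of `∑ (ω ^ k z) ^ i exp (n h ω ^ k z)`. -/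
noncomputable def eulerSum (p : ℕ) (z : ℂ) (h : ℝ) (n i : ℕ) : ℂ :=
  ∑ k ∈ Finset.range p, (omega p ^ k * z) ^ i * (1 + h * (omega p ^ k * z)) ^ n

lemma eulerSum_succ (p : ℕ) (z : ℂ) (h : ℝ) (n i : ℕ) :
    eulerSum p z h (n + 1) i = eulerSum p z h n i + h * eulerSum p z h n (i + 1) := by
  simp only [eulerSum, Finset.mul_sum, ← Finset.sum_add_distrib]
  exact Finset.sum_congr rfl fun k _ ↦ by ring

lemma eulerSum_add_self {p : ℕ} (hp : p ≠ 0) (z : ℂ) (h : ℝ) (n i : ℕ) :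
    eulerSum p z h n (i + p) = z ^ p * eulerSum p z h n i := by
  simp only [eulerSum, Finset.mul_sum]
  refine Finset.sum_congr rfl fun k _ ↦ ?_
  have : (omega p ^ k) ^ p = 1 := by
    rw [pow_right_comm, (isPrimitiveRoot_omega hp).pow_eq_one, one_pow]
  rw [pow_add _ i p, mul_pow _ z p, this]
  ring

lemma eulerSum_zero_of_not_dvd {p : ℕ} (hp : p ≠ 0) (z : ℂ) (h : ℝ) {i : ℕ} (hi : ¬ p ∣ i) :
    eulerSum p z h 0 i = 0 := by
  have hω := isPrimitiveRoot_omega hp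
  have h1 : omega p ^ i - 1 ≠ 0 := sub_ne_zero.2 fun h ↦ hi ((hω.pow_eq_one_iff_dvd i).1 h)
  have h2 : ∑ k ∈ Finset.range p, (omega p ^ i) ^ k = 0 := by
    have h3 := mul_geom_sum (omega p ^ i) p
    rw [pow_right_comm, hω.pow_eq_one, one_pow, sub_self] at h3
    exact (mul_eq_zero.1 h3).resolve_left h1
  simp only [eulerSum, pow_zero, mul_one, mul_pow, ← Finset.sum_mul]
  simp only [pow_right_comm (omega p) _ i, h2, zero_mul]

lemma im_conj_mul_mul_self (a w : ℂ) : (conj a * (w * a)).im = w.im * normSq a := by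
  rw [mul_left_comm, ← normSq_eq_conj_mul_self, im_mul_ofReal]

/-- Induction on `n`: an Euler step expands the product into those at `(i, j)`, `(i+1, j)`, `(i,
j+1)`, `(i+1, j+1)` with nonnegative weights. For `i < j < i + p` these index pairs stay in the
allowed range; the extreme cases `j = i` and `j = i + p` are direct. -/
lemma im_conj_eulerSum_mul_nonneg {p : ℕ} (hp : p ≠ 0) {z : ℂ} (hz : 0 ≤ (z ^ p).im) {h : ℝ}
    (hh : 0 ≤ h) (n : ℕ) : ∀ i j, i ≤ j → j ≤ i + p →
      0 ≤ (conj (eulerSum p z h n i) * eulerSum p z h n j).im := by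
  have key : ∀ n i j, i ≤ j → j ≤ i + p →
      (i < j → j < i + p → 0 ≤ (conj (eulerSum p z h n i) * eulerSum p z h n j).im) →
      0 ≤ (conj (eulerSum p z h n i) * eulerSum p z h n j).im := by
    intro n i j hij hji H
    rcases hij.eq_or_lt with rfl | hij
    · have := im_conj_mul_mul_self (eulerSum p z h n i) 1
      simp only [one_mul, one_im, zero_mul] at this
      exact this.ge
    rcases hji.eq_or_lt with rfl | hji
    · rw [eulerSum_add_self hp, im_conj_mul_mul_self]
      exact mul_nonneg hz (normSq_nonneg _)
    · exact H hij hji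
  induction n with
  | zero =>
    refine fun i j h1 h2 ↦ key 0 i j h1 h2 fun hij hji ↦ ?_
    by_cases hi : p ∣ i
    · have hj : ¬ p ∣ j := fun hj ↦ by
        have := Nat.le_of_dvd (by omega) (Nat.dvd_sub hj hi)
        omega
      simp [eulerSum_zero_of_not_dvd hp z h hj]
    · simp [eulerSum_zero_of_not_dvd hp z h hi]
  | succ n ih =>
    refine fun i j h1 h2 ↦ key (n + 1) i j h1 h2 fun hij hji ↦ ?_
    have e1 := ih i j (by omega) (by omega)
    have e2 := mul_nonneg hh (ih (i + 1) j (by omega) (by omega))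
    have e3 := mul_nonneg hh (ih i (j + 1) (by omega) (by omega))
    have e4 := mul_nonneg (mul_nonneg hh hh) (ih (i + 1) (j + 1) (by omega) (by omega))
    have : conj (eulerSum p z h (n + 1) i) * eulerSum p z h (n + 1) j =
        conj (eulerSum p z h n i) * eulerSum p z h n j
        + h * (conj (eulerSum p z h n (i + 1)) * eulerSum p z h n j)
        + h * (conj (eulerSum p z h n i) * eulerSum p z h n (j + 1))
        + (h * h : ℝ) * (conj (eulerSum p z h n (i + 1)) * eulerSum p z h n (j + 1)) := by
      rw [eulerSum_succ, eulerSum_succ, map_add, map_mul, conj_ofReal, ofReal_mul]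
      ring
    rw [this]
    simp only [add_im, im_ofReal_mul]
    linarith

lemma tendsto_eulerSum (p : ℕ) (z : ℂ) (i : ℕ) :
    Tendsto (fun n : ℕ ↦ eulerSum p z (1 / n) n i) atTop
      (𝓝 (∑ k ∈ Finset.range p, (omega p ^ k * z) ^ i * exp (omega p ^ k * z))) := by
  refine tendsto_finsetSum _ fun k _ ↦ Tendsto.const_mul _ ?_
  refine (tendsto_one_add_div_pow_exp (omega p ^ k * z)).congr fun n ↦ ?_
  push_cast
  ring

lemma hasDerivAt_expSum (p : ℕ) (z : ℂ) :
    HasDerivAt (expSum p) (∑ k ∈ Finset.range p, omega p ^ k * exp (omega p ^ k * z)) z := by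
  refine HasDerivAt.fun_sum fun k _ ↦ ?_
  simpa [mul_comm] using ((hasDerivAt_id z).const_mul (omega p ^ k)).cexp

lemma analyticOnNhd_expSum (p : ℕ) : AnalyticOnNhd ℂ (expSum p) Set.univ :=
  analyticOnNhd_univ_iff_differentiable.2 fun z ↦ (hasDerivAt_expSum p z).differentiableAt

lemma im_conj_expSum_mul_deriv_nonneg {p : ℕ} (hp : p ≠ 0) {z : ℂ} (hz : 0 ≤ (z ^ p).im) :
    0 ≤ (conj (expSum p z) * (z * deriv (expSum p) z)).im := by
  have h0 := tendsto_eulerSum p z 0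
  have h1 := tendsto_eulerSum p z 1
  have h := (continuous_im.tendsto _).comp (((continuous_conj.tendsto _).comp h0).mul h1)
  have e0 : ∑ k ∈ Finset.range p, (omega p ^ k * z) ^ 0 * exp (omega p ^ k * z) = expSum p z := by
    simp [expSum]
  have e1 : ∑ k ∈ Finset.range p, (omega p ^ k * z) ^ 1 * exp (omega p ^ k * z) =
      z * deriv (expSum p) z := by
    rw [(hasDerivAt_expSum p z).deriv, Finset.mul_sum]
    exact Finset.sum_congr rfl fun k _ ↦ by ring
  rw [e0, e1] at h
  exact ge_of_tendsto' h fun n ↦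
    im_conj_eulerSum_mul_nonneg hp hz (by positivity) n 0 1 (by omega) (by omega)

lemma hasDerivAt_arc (r θ : ℝ) :
    HasDerivAt (fun t : ℝ ↦ (r : ℂ) * exp (t * I)) (r * exp (θ * I) * I) θ := by
  simpa [mul_assoc] using
    (((hasDerivAt_id (θ : ℂ)).mul_const I).cexp.const_mul (r : ℂ)).comp_ofReal

/-- Along a circle around the origin, the modulus of `expSum p` decreases from the positive real
axis to the ray of argument `π / p`. -/
lemma antitoneOn_norm_sq_expSum_arc {p : ℕ} (hp : p ≠ 0) {r : ℝ} (hr : 0 ≤ r) :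
    AntitoneOn (fun θ : ℝ ↦ ‖expSum p (r * exp (θ * I))‖ ^ 2) (Set.Icc 0 (Real.pi / p)) := by
  have hd : ∀ θ : ℝ, HasDerivAt (fun θ : ℝ ↦ ‖expSum p (r * exp (θ * I))‖ ^ 2)
      (2 * inner ℝ (expSum p (r * exp (θ * I)))
        (deriv (expSum p) (r * exp (θ * I)) * (r * exp (θ * I) * I))) θ := fun θ ↦
    (((hasDerivAt_expSum p _).differentiableAt.hasDerivAt).comp θ (hasDerivAt_arc r θ)).norm_sq
  refine antitoneOn_of_deriv_nonpos (convex_Icc _ _)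
    (fun θ _ ↦ (hd θ).continuousAt.continuousWithinAt)
    (fun θ _ ↦ (hd θ).differentiableAt.differentiableWithinAt) fun θ hθ ↦ ?_
  rw [interior_Icc] at hθ
  have hp' : (0 : ℝ) < p := by positivity
  have hz : 0 ≤ (((r : ℂ) * exp (θ * I)) ^ p).im := by
    have : ((r : ℂ) * exp (θ * I)) ^ p = (r ^ p : ℝ) * exp ((p * θ : ℝ) * I) := by
      rw [mul_pow, ← Complex.exp_nat_mul]
      push_cast
      ring_nf
    rw [this, im_ofReal_mul, exp_ofReal_mul_I_im]
    refine mul_nonneg (by positivity) (Real.sin_nonneg_of_nonneg_of_le_pi ?_ ?_)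
    · exact mul_nonneg hp'.le hθ.1.le
    · have := (lt_div_iff₀ hp').1 hθ.2
      linarith
  have key := im_conj_expSum_mul_deriv_nonneg hp hz
  rw [(hd θ).deriv, Complex.inner]
  generalize (r : ℂ) * exp (θ * I) = z at key ⊢
  have : conj (expSum p z) * (deriv (expSum p) z * (z * I)) =
      conj (expSum p z) * (z * deriv (expSum p) z) * I := by ring
  rw [mul_comm (deriv (expSum p) z * (z * I)), this, mul_I_re]
  linarith

/-- Monotonicity makes zeros accumulate at such a point, so the identity theorem applies. -/
lemma expSum_arc_ne_zero {p : ℕ} (hp : p ≠ 0) {r θ : ℝ} (hr : 0 < r) (h0 : 0 ≤ θ)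
    (hθ : θ < Real.pi / p) : expSum p (r * exp (θ * I)) ≠ 0 := by
  intro hz
  have hev : ∀ᶠ t : ℝ in 𝓝[>] θ, expSum p (r * exp (t * I)) = 0 := by
    filter_upwards [Ioo_mem_nhdsGT hθ] with t ht
    have := antitoneOn_norm_sq_expSum_arc hp hr.le ⟨h0, hθ.le⟩ ⟨h0.trans ht.1.le, ht.2.le⟩ ht.1.le
    simpa [hz] using this
  have hne : (r : ℂ) * exp (θ * I) * I ≠ 0 := by simp [hr.ne']
  have ht := ((hasDerivAt_arc r θ).tendsto_nhdsNE hne).mono_left (nhdsGT_le_nhdsNE θ)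
  have hfr := (ht.frequently hev.frequently : ∃ᶠ z in 𝓝[≠] ((r : ℂ) * exp (θ * I)), expSum p z = 0)
  have : expSum p 0 = 0 := (analyticOnNhd_expSum p).eqOn_zero_of_preconnected_of_frequently_eq_zero
    isPreconnected_univ (Set.mem_univ _) hfr (Set.mem_univ 0)
  rw [expSum_zero] at this
  exact hp (by exact_mod_cast this)

lemma omega_mul_conj_arc (p : ℕ) (r θ : ℝ) :
    omega p * conj ((r : ℂ) * exp (θ * I)) = r * exp ((2 * Real.pi / p - θ : ℝ) * I) := by
  rw [map_mul, ← exp_conj, omega, mul_left_comm, ← Complex.exp_add, conj_ofReal]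
  simp only [map_mul, conj_ofReal, conj_I]
  push_cast
  ring_nf

/-- The symmetry `z ↦ ω * conj z` reflects the sector across its bisector `θ = π/p`. -/
lemma eq_pi_div_of_expSum_arc_eq_zero {p : ℕ} (hp : p ≠ 0) {r θ : ℝ} (hr : 0 < r) (h0 : 0 ≤ θ)
    (hθ : θ ≤ 2 * Real.pi / p) (h : expSum p (r * exp (θ * I)) = 0) : θ = Real.pi / p := by
  have e : 2 * Real.pi / p = 2 * (Real.pi / p) := by ring
  refine le_antisymm (not_lt.1 fun hlt ↦ ?_) (not_lt.1 fun hlt ↦ expSum_arc_ne_zero hp hr h0 hlt h)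
  refine expSum_arc_ne_zero (θ := 2 * Real.pi / p - θ) hp hr (by linarith) (by linarith) ?_
  rw [← omega_mul_conj_arc, expSum_omega_mul hp, expSum_conj hp, h, map_zero]

lemma arc_pi_div_mem_baseRay {p : ℕ} (hp : 3 ≤ p) {r : ℝ} (hr : 0 < r) :
    (r : ℂ) * exp ((Real.pi / p : ℝ) * I) ∈ baseRay p := by
  have hp' : (3 : ℝ) ≤ p := by exact_mod_cast hp
  have hlt : Real.pi / p < Real.pi / 2 :=
    div_lt_div_of_pos_left Real.pi_pos two_pos (by linarith)
  have hcos : 0 < Real.cos (Real.pi / p) :=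
    Real.cos_pos_of_mem_Ioo ⟨by have : 0 < Real.pi / p := by positivity
                                linarith [Real.pi_pos], hlt⟩
  constructor
  · rw [im_ofReal_mul, re_ofReal_mul, exp_ofReal_mul_I_im, exp_ofReal_mul_I_re, mul_left_comm,
      Real.tan_mul_cos hcos.ne']
  · rw [re_ofReal_mul, exp_ofReal_mul_I_re]
    exact mul_pos hr hcos

lemma exists_arc_rotation {p : ℕ} (hp : p ≠ 0) (z : ℂ) :
    ∃ k < p, ∃ θ : ℝ, 0 ≤ θ ∧ θ ≤ 2 * Real.pi / p ∧
      z = omega p ^ k * (‖z‖ * exp (θ * I)) := by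
  obtain ⟨φ, hφ0, hφ1, hφ⟩ : ∃ φ : ℝ, 0 ≤ φ ∧ φ < 2 * Real.pi ∧ z = ‖z‖ * exp (φ * I) := by
    rcases le_or_gt 0 (arg z) with h | h
    · exact ⟨arg z, h, by linarith [arg_le_pi z, Real.pi_pos], (norm_mul_exp_arg_mul_I z).symm⟩
    · refine ⟨arg z + 2 * Real.pi, by linarith [neg_pi_lt_arg z, Real.pi_pos], by linarith, ?_⟩
      push_cast
      rw [add_mul, Complex.exp_add, exp_two_pi_mul_I, mul_one, norm_mul_exp_arg_mul_I]
  have hc : 0 < 2 * Real.pi / p := by positivity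
  have hp' : (p : ℝ) ≠ 0 := by exact_mod_cast hp
  refine ⟨⌊φ / (2 * Real.pi / p)⌋₊, ?_, φ - ⌊φ / (2 * Real.pi / p)⌋₊ * (2 * Real.pi / p), ?_, ?_, ?_⟩
  · rw [Nat.floor_lt (by positivity), div_lt_iff₀ hc, mul_div_cancel₀ _ hp']
    exact hφ1
  · have := (le_div_iff₀ hc).1 (Nat.floor_le (div_nonneg hφ0 hc.le))
    linarith
  · have := (div_lt_iff₀ hc).1 (Nat.lt_floor_add_one (φ / (2 * Real.pi / p)))
    linarith
  · conv_lhs => rw [hφ]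
    rw [mul_left_comm, omega, ← Complex.exp_nat_mul, ← Complex.exp_add]
    congr 2
    push_cast
    ring

end ExpSums

theorem theorem3p2 (p : ℕ) (hp : 3 ≤ p) :
    {z : ℂ | ExpSums.expSum p z = 0} ⊆ ⋃ k ∈ Finset.range p, ExpSums.ray p k := by
  intro z hz
  have hp0 : p ≠ 0 := by omega
  have hz : ExpSums.expSum p z = 0 := hz
  have hz0 : z ≠ 0 := by
    rintro rfl
    rw [ExpSums.expSum_zero] at hz
    exact hp0 (by exact_mod_cast hz)
  obtain ⟨k, hk, θ, h0, h1, hzθ⟩ := ExpSums.exists_arc_rotation hp0 z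
  have hr : 0 < ‖z‖ := norm_pos_iff.2 hz0
  have hzero : ExpSums.expSum p (‖z‖ * Complex.exp (θ * Complex.I)) = 0 := by
    rw [← ExpSums.expSum_omega_pow_mul hp0 k, ← hzθ, hz]
  have hθ := ExpSums.eq_pi_div_of_expSum_arc_eq_zero hp0 hr h0 h1 hzero
  refine Set.mem_iUnion₂.2 ⟨k, Finset.mem_range.2 hk, _,
    ExpSums.arc_pi_div_mem_baseRay hp hr, ?_⟩
  conv_rhs => rw [hzθ, hθ, ExpSums.omega, ← Complex.exp_nat_mul]
  beta_reduce
  congr 2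
  push_cast
  ring
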